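/- Let $\lambda$ be an infinite cardinal and let $\gamma$ be an ordinal with $\lambda\le\gamma<(2^\lambda)^+$. Then there is an abstract elementary class (AEC) $\mathbf K$ with Löwenheim–Skolem number $\mathrm{LS}(\mathbf K)=\lambda$ such that 1. $\mathbf K$ is stable: there is a cardinal $\mu\ge\mathrm{LS}(\mathbf K)$ such that $|\mathrm{gS}^{<2}(A;M)|\le\mu$ for every $M\in\mathbf K$ and every $A\subseteq|M|$ with $|A|\le\mu$; 2. for every infinite cardinal $\mu\le\beth_\gamma(\lambda)$, $\mathbf K$ has the order property of length $\mu$: there are a natural number $n\ge1$, a model $M\in\mathbf K$ and a sequence $\langle a_i:i<\mu\rangle$ of $n$-tuples of $M$ such that $\mathrm{gtp}(a_{i_0}a_{i_1}/\emptyset;M)\ne\mathrm{gtp}(a_{j_1}a_{j_0}/\emptyset;M)$ whenever $i_0<i_1<\mu$ and $j_0<j_1<\mu$; 3. $\mathbf K$ has the joint embedding property and no maximal model; 4. $\mathbf K$ is $(<\aleph_0)$-tame: any two distinct Galois types of length $<2$ over a set $A$ contained in some model of $\mathbf K$ have distinct restrictions to some finite $A_0\subseteq A$; 5. $\mathbf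 K$ does not have the amalgamation property. Here $\beth_0(\lambda)=\lambda$, $\beth_{\beta+1}(\lambda)=2^{\beth_\beta(\lambda)}$, and $\beth_\delta(\lambda)=\sup_{\beta<\delta}\beth_\beta(\lambda)$ for limit $\delta$. The Galois type $\mathrm{gtp}(a/A;M)$ is the class of the triple $(a,A,M)$ under the transitive closure of the relation relating $(a,A,M)$ and $(b,A,N)$ when there are $\mathbf K$-embeddings $f:M\to P$ and $g:N\to P$ into some $P\in\mathbf K$ with $f\restriction A=g\restriction A$ and $f(a)=g(b)$; $\mathrm{gS}^{<2}(A;M)$ is the set of the types over $A$ of tuples of length $<2$ from $M$. -/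

import Mathlib

open scoped FirstOrder Cardinal

universe u

/-- The relative beth function `ℶ_o(κ)`: `ℶ_0(κ) = κ`, `ℶ_{o+1}(κ) = 2 ^ ℶ_o(κ)`, and
`ℶ_o(κ) = sup_{a < o} ℶ_a(κ)` at limit ordinals `o`. -/
noncomputable def bethOver (κ : Cardinal.{u}) (o : Ordinal.{u}) : Cardinal.{u} :=
  Ordinal.limitRecOn o κ (fun _ c => 2 ^ c) (fun o _ ih => ⨆ a : Set.Iio o, ih a.1 a.2)

theorem bethOver_zero (κ : Cardinal.{u}) : bethOver κ 0 = κ := by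
  simp [bethOver]

theorem bethOver_succ (κ : Cardinal.{u}) (o : Ordinal.{u}) :
    bethOver κ (Order.succ o) = 2 ^ bethOver κ o := by
  simp [bethOver]

theorem bethOver_limit (κ : Cardinal.{u}) (o : Ordinal.{u}) (ho : Order.IsSuccLimit o) :
    bethOver κ o = ⨆ a : Set.Iio o, bethOver κ a.1 := by
  simp [bethOver, Ordinal.limitRecOn_limit _ _ _ _ ho]

/-- An abstract elementary class `(K, ≤_K)` in the finitary language `L`; the class consists of
nonempty `L`-structures in `Type u`.

The order `≤_K` is given through its `K`-embeddings: `IsStrong f`, for an `L`-embedding `f : M → N`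
between members of `K`, says that `f[M] ≤_K N`. In particular, for a substructure `S` of `N`,
`S ≤_K N` is `IsStrong S.subtype`. -/
structure AEC (L : FirstOrder.Language.{u, u}) where
  /-- membership in `K` -/
  Mem : ∀ (M : Type u) [L.Structure M], Prop
  /-- `f[M] ≤_K N` -/
  IsStrong : ∀ {M N : Type u} [L.Structure M] [L.Structure N], (M ↪[L] N) → Prop
  /-- structures are nonempty -/
  nonempty_of_mem : ∀ {M : Type u} [L.Structure M], Mem M → Nonempty M
  /-- `≤_K` is a relation between members of `K` -/
  mem_of_isStrong : ∀ {M N : Type u} [L.Structure M] [L.Structure N] (f : M ↪[L] N),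
    IsStrong f → Mem M ∧ Mem N
  /-- `K` is closed under isomorphism -/
  mem_of_equiv : ∀ {M N : Type u} [L.Structure M] [L.Structure N] (_ : M ≃[L] N), Mem M → Mem N
  /-- `≤_K` is reflexive; isomorphisms between members of `K` are `K`-embeddings -/
  isStrong_equiv : ∀ {M N : Type u} [L.Structure M] [L.Structure N] (e : M ≃[L] N),
    Mem M → IsStrong e.toEmbedding
  /-- `≤_K` is transitive (and, with the previous clause, invariant under isomorphism) -/
  isStrong_comp : ∀ {M N P : Type u} [L.Structure M] [L.Structure N] [L.Structure P]
    (f : M ↪[L] N) (g : N ↪[L] P), IsStrong f → IsStrong g → IsStrong (g.comp f)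
  /-- coherence: if `M₀ ⊆ M₁ ≤_K M₂` and `M₀ ≤_K M₂`, with `M₁` in `K`, then `M₀ ≤_K M₁` -/
  coherence : ∀ {M N P : Type u} [L.Structure M] [L.Structure N] [L.Structure P]
    (f : M ↪[L] N) (g : N ↪[L] P), IsStrong (g.comp f) → IsStrong g → IsStrong f
  /-- Tarski-Vaught chain axioms: if `N` is the union of a `≤_K`-increasing well-ordered chain
  `(S i)` of members of `K`, then `N` is in `K`, each `S i ≤_K N`, and `N` is a `≤_K`-least upper
  bound: if `N ⊆ P`, `P` is in `K` and each `S i ≤_K P`, then `N ≤_K P`. -/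
  chain : ∀ {N : Type u} [L.Structure N] {ι : Type u} [LinearOrder ι] [WellFoundedLT ι]
    [Nonempty ι] (S : ι → L.Substructure N) (hS : Monotone S),
    (∀ x : N, ∃ i, x ∈ S i) → (∀ i, Mem (S i)) →
    (∀ (i j : ι) (hij : i ≤ j), IsStrong (FirstOrder.Language.Substructure.inclusion (hS hij))) →
    Mem N ∧ (∀ i, IsStrong (S i).subtype) ∧
      ∀ {P : Type u} [L.Structure P] (f : N ↪[L] P), Mem P →
        (∀ i, IsStrong (f.comp (S i).subtype)) → IsStrong f
  /-- Löwenheim-Skolem axiom -/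
  exists_ls : ∃ κ : Cardinal.{u}, ℵ₀ ≤ κ ∧ L.card ≤ κ ∧
    ∀ {M : Type u} [L.Structure M], Mem M → ∀ X : Set M,
      ∃ S : L.Substructure M, X ⊆ (S : Set M) ∧ IsStrong S.subtype ∧ #S ≤ #X + κ

namespace AEC

variable {L : FirstOrder.Language.{u, u}} (K : AEC L)

/-- The Löwenheim-Skolem number `LS(K)`: the least cardinal `κ ≥ |L| + ℵ₀` such that every subset
`X` of every `M` in `K` is contained in some `S ≤_K M` with `|S| ≤ |X| + κ`. -/
noncomputable def LS : Cardinal.{u} :=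
  sInf {κ : Cardinal.{u} | ℵ₀ ≤ κ ∧ L.card ≤ κ ∧
    ∀ {M : Type u} [L.Structure M], K.Mem M → ∀ X : Set M,
      ∃ S : L.Substructure M, X ⊆ (S : Set M) ∧ K.IsStrong S.subtype ∧ #S ≤ #X + κ}

/-- Amalgamation property. -/
def AP : Prop :=
  ∀ {M₀ M₁ M₂ : Type u} [L.Structure M₀] [L.Structure M₁] [L.Structure M₂]
    (f₁ : M₀ ↪[L] M₁) (f₂ : M₀ ↪[L] M₂), K.IsStrong f₁ → K.IsStrong f₂ →
    ∃ (N : Type u) (_ : L.Structure N) (g₁ : M₁ ↪[L] N) (g₂ : M₂ ↪[L] N),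
      K.IsStrong g₁ ∧ K.IsStrong g₂ ∧ ∀ x : M₀, g₁ (f₁ x) = g₂ (f₂ x)

/-- Joint embedding property. -/
def JEP : Prop :=
  ∀ {M₁ M₂ : Type u} [L.Structure M₁] [L.Structure M₂], K.Mem M₁ → K.Mem M₂ →
    ∃ (N : Type u) (_ : L.Structure N) (g₁ : M₁ ↪[L] N) (g₂ : M₂ ↪[L] N),
      K.IsStrong g₁ ∧ K.IsStrong g₂

/-- No maximal model: every member of `K` has a proper `≤_K`-extension. -/
def NMM : Prop :=
  ∀ {M : Type u} [L.Structure M], K.Mem M →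
    ∃ (N : Type u) (_ : L.Structure N) (g : M ↪[L] N),
      K.IsStrong g ∧ ¬ Function.Surjective g

/-- A triple `(a, A, M)`: a member `M` of `K`, a copy of the set `A` inside `M` and a tuple `a` of
elements of `M` indexed by `I`. -/
structure PreType (I : Type) (A : Type u) where
  M : Type u
  [str : L.Structure M]
  mem : K.Mem M
  base : A ↪ M
  tuple : I → M

attribute [instance] PreType.str

variable {K}

/-- Atomic equivalence of `(a, A, M)` and `(b, A, N)`: there are `K`-embeddings of `M` and `N` into
a common member of `K` which agree on `A` and map `a` and `b` to the same tuple. -/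
def PreType.AtomicEq {I : Type} {A : Type u} (p q : K.PreType I A) : Prop :=
  ∃ (P : Type u) (_ : L.Structure P) (f : p.M ↪[L] P) (g : q.M ↪[L] P),
    K.IsStrong f ∧ K.IsStrong g ∧
      (∀ x : A, f (p.base x) = g (q.base x)) ∧ ∀ i : I, f (p.tuple i) = g (q.tuple i)

/-- The same tuple over a subset `A₀` of `A`. -/
def PreType.restrict {I : Type} {A : Type u} (p : K.PreType I A) (A₀ : Set A) :
    K.PreType I A₀ where
  M := p.M
  mem := p.mem
  base := (Function.Embedding.subtype (· ∈ A₀)).trans p.base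
  tuple := p.tuple

variable (K)

/-- Galois (orbital) types over `A` of tuples indexed by `I`: classes of triples `(a, A, M)` modulo
the transitive closure of the (reflexive and symmetric) relation of atomic equivalence. -/
def GaloisType (I : Type) (A : Type u) : Type (u + 1) :=
  Quot (PreType.AtomicEq (K := K) (I := I) (A := A))

variable {K}

/-- The restriction `p ↾ A₀` of a Galois type over `A` to a subset `A₀` of `A`. -/
def GaloisType.restrict {I : Type} {A : Type u} (A₀ : Set A) :
    K.GaloisType I A → K.GaloisType I A₀ :=
  Quot.map (fun p => p.restrict A₀) (by
    rintro p q ⟨P, hP, f, g, hf, hg, hA, ha⟩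
    exact ⟨P, hP, f, g, hf, hg, fun x => hA x.1, ha⟩)

/-- `gtp(a/A; M)`, for a member `M` of `K`, a subset `A` of `M` and a tuple `a` in `M`. -/
def gtp {I : Type} {M : Type u} [L.Structure M] (hM : K.Mem M) (A : Set M) (a : I → M) :
    K.GaloisType I A :=
  Quot.mk _ ⟨M, hM, Function.Embedding.subtype (· ∈ A), a⟩

/-- The set `gS^{<2}(A; M)` of Galois types over `A` of the tuples of length `< 2` in `M`. -/
def typesLTTwo {M : Type u} [L.Structure M] (hM : K.Mem M) (A : Set M) :
    Set (Σ n : ℕ, K.GaloisType (Fin n) A) :=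
  {p | ∃ n : ℕ, n < 2 ∧ ∃ a : Fin n → M, p = ⟨n, gtp hM A a⟩}

variable (K)

/-- `K` is stable in `μ`: `|gS^{<2}(A; M)| ≤ μ` for all `M` in `K` and `A ⊆ M` with `|A| ≤ μ`. -/
def StableIn (μ : Cardinal.{u}) : Prop :=
  ∀ {M : Type u} [L.Structure M] (hM : K.Mem M) (A : Set M), #A ≤ μ →
    #(typesLTTwo hM A) ≤ Cardinal.lift.{u + 1} μ

/-- `K` is stable: it is stable in some `μ ≥ LS(K)`. -/
def Stable : Prop :=
  ∃ μ : Cardinal.{u}, K.LS ≤ μ ∧ K.StableIn μ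

/-- `K` is `(< κ)`-tame (for types of length `< 2`): two distinct Galois types over a set `A` have
distinct restrictions to some `A₀ ⊆ A` with `|A₀| < κ`. -/
def Tame (κ : Cardinal.{u}) : Prop :=
  ∀ (A : Type u) (n : ℕ), n < 2 → ∀ p q : K.GaloisType (Fin n) A, p ≠ q →
    ∃ A₀ : Set A, #A₀ < κ ∧ p.restrict A₀ ≠ q.restrict A₀

/-- `K` has the `n`-order property of length `μ`: in some `M` in `K` there is a sequence
`(a_i : i < μ)` of `n`-tuples such that, whenever `i₀ < i₁ < μ` and `j₀ < j₁ < μ`, the types over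
the empty set of the concatenations `a_{i₀} a_{i₁}` and `a_{j₁} a_{j₀}` in `M` are distinct. -/
def HasOrderPropertyOfArity (n : ℕ) (μ : Cardinal.{u}) : Prop :=
  ∃ (M : Type u) (_ : L.Structure M) (hM : K.Mem M) (a : μ.ord.ToType → Fin n → M),
    ∀ i₀ i₁ j₀ j₁ : μ.ord.ToType, i₀ < i₁ → j₀ < j₁ →
      gtp hM ∅ (Fin.append (a i₀) (a i₁)) ≠ gtp hM ∅ (Fin.append (a j₁) (a j₀))

/-- `K` has the order property of length `μ`: the `n`-order property of length `μ` for some finite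
`n ≥ 1`. -/
def HasOrderProperty (μ : Cardinal.{u}) : Prop :=
  ∃ n : ℕ, 1 ≤ n ∧ K.HasOrderPropertyOfArity n μ

end AEC

/-! Fix a set `I` of size `λ`, put `β = λ + γ` (ordinal sum), and consider disjoint unions of
extensional membership structures whose elements carry ranks below `β`. Ranks are coded by `λ` unary
predicates. Since there are `2 ^ λ` codes and `β < (2 ^ λ)⁺`, distinct ranks can get distinct codes
although the language has size `λ`. A binary function `wit` selects a witness of extensionality.
With it, every axiom is a condition on finitely many elements at a time, inherited by substructures
and preserved by unions of chains. So the class, ordered by substructure, is an AEC with LS number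
`λ`. Over a nonempty set of parameters and entries, Galois types are atomic types of generated
substructures, whence finite tameness. Each component collapses injectively into `V_β`, so its size
is bounded once and for all. An element outside the components meeting `A` has a type over `A` fixed
by its atomic type over the empty set; this gives stability. Yet `V_β` itself is a component, on
which the extra relation `ord` is arbitrary. It can copy a well-order of any length up to `|V_β| ≥
ℶ_γ(λ)`, which gives the order property. Disjoint unions give joint embedding and proper extensions.
Amalgamation fails because extensionality forces two rank-zero elements of one component to
coincide, even if they are related by `ord` to a common point in different ways. -/

open FirstOrder.Language (Term Substructure)
open FirstOrder.Language.Structure (RelMap funMap)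

/-! ### Atomic types and generated substructures. -/

/-- The atomic type of a family `v` of elements of a structure: the equations between terms and the
atomic relations between terms which `v` satisfies. -/
def FirstOrder.Language.atomicType (L : FirstOrder.Language.{u, u}) {α M : Type u} [L.Structure M]
    (v : α → M) :
    Set (L.Term α × L.Term α) × Set (Σ n, L.Relations n × (Fin n → L.Term α)) :=
  ({t | t.1.realize v = t.2.realize v}, {r | RelMap r.2.1 fun i => (r.2.2 i).realize v})

namespace FirstOrder.Language

variable {L : FirstOrder.Language.{u, u}} {α M N : Type u} [L.Structure M] [L.Structure N]

theorem atomicType_eq_iff {v : α → M} {w : α → N} :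
    L.atomicType v = L.atomicType w ↔
      (∀ s t : L.Term α, s.realize v = t.realize v ↔ s.realize w = t.realize w) ∧
      ∀ (n : ℕ) (R : L.Relations n) (ts : Fin n → L.Term α),
        (RelMap R fun i => (ts i).realize v) ↔ RelMap R fun i => (ts i).realize w := by
  simp only [atomicType, Prod.mk.injEq, Set.ext_iff, Set.mem_ofPred_eq, Prod.forall, Sigma.forall]

theorem atomicType_comp (f : M ↪[L] N) (v : α → M) :
    L.atomicType (fun i => f (v i)) = L.atomicType v := by
  have key : ∀ t : L.Term α, t.realize (fun i => f (v i)) = f (t.realize v) := fun t =>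
    FirstOrder.Language.HomClass.realize_term f
  rw [atomicType_eq_iff]
  refine ⟨fun s t => ?_, fun n R ts => ?_⟩
  · rw [key, key, f.injective.eq_iff]
  · simp only [key]
    exact f.map_rel R fun i => (ts i).realize v

theorem mem_closure_range_iff {v : α → M} {x : M} :
    x ∈ Substructure.closure L (Set.range v) ↔ ∃ t : L.Term α, t.realize v = x := by
  rw [Substructure.mem_closure_iff_exists_term]
  constructor
  · rintro ⟨t, rfl⟩
    choose g hg using fun y : Set.range v => y.2
    refine ⟨t.relabel g, ?_⟩
    rw [Term.realize_relabel]
    congr 1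
    exact funext hg
  · rintro ⟨t, rfl⟩
    refine ⟨t.relabel (Set.rangeFactorization v), ?_⟩
    rw [Term.realize_relabel]
    rfl

/-- Families with the same atomic type generate isomorphic substructures. -/
theorem exists_embedding_of_atomicType_eq {v : α → M} {w : α → N}
    (h : L.atomicType v = L.atomicType w) :
    ∃ f : Substructure.closure L (Set.range v) ↪[L] N,
      ∀ i, f ⟨v i, Substructure.subset_closure ⟨i, rfl⟩⟩ = w i := by
  obtain ⟨h₁, h₂⟩ := atomicType_eq_iff.1 h
  -- Each element gets a term naming it from `v`, and is sent to the value of that term at `w`. The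
  -- choice of term is harmless, because `v` and `w` satisfy the same equations.
  choose t ht using fun x : Substructure.closure L (Set.range v) => mem_closure_range_iff.1 x.2
  refine ⟨⟨⟨fun x => (t x).realize w, fun x y hxy => ?_⟩, fun {n} F xs => ?_, fun {n} R xs => ?_⟩,
    fun i => ?_⟩
  · have := (h₁ _ _).2 hxy
    rw [ht, ht] at this
    exact Subtype.ext this
  · refine (h₁ (t (funMap F xs)) (Term.func F fun i => t (xs i))).1 ?_
    rw [ht, Term.realize_func]
    simp only [ht]
    rfl
  · refine (h₂ n R fun i => t (xs i)).symm.trans ?_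
    simp only [ht]
    rfl
  · exact (h₁ (t _) (Term.var i)).1 (ht _)

end FirstOrder.Language

/-! ### Hereditary classes: LS number, Galois types, tameness. -/

namespace AEC

variable {L : FirstOrder.Language.{u, u}}

theorem exists_substructure_card_le {M : Type u} [L.Structure M] [Nonempty M] (X : Set M) :
    ∃ S : L.Substructure M, X ⊆ (S : Set M) ∧ Nonempty S ∧ #S ≤ #X + max ℵ₀ L.card := by
  obtain ⟨m⟩ := ‹Nonempty M›
  refine ⟨Substructure.closure L (insert m X),
    (Set.subset_insert _ _).trans Substructure.subset_closure,
    ⟨⟨m, Substructure.subset_closure (Set.mem_insert _ _)⟩⟩, ?_⟩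
  have h := Substructure.lift_card_closure_le (L := L) (s := insert m X)
  have hF : #(Σ i, L.Functions i) ≤ L.card := by
    rw [FirstOrder.Language.card_eq_card_functions_add_card_relations, Cardinal.mk_sigma]
    simp
  have hi : #(insert m X : Set M) ≤ #X + 1 := Cardinal.mk_insert_le
  simp only [Cardinal.lift_id] at h
  refine h.trans (max_le ((le_max_left _ _).trans le_add_self) ?_)
  refine (add_le_add hi hF).trans ?_
  rw [add_assoc]
  refine add_le_add le_rfl ?_
  exact Cardinal.add_le_of_le (le_max_left _ _) (Cardinal.one_le_aleph0.trans (le_max_left _ _))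
    (le_max_right _ _)

/-- The abstract elementary class of the nonempty structures in a class `Φ` which is closed under
substructures and unions of chains, ordered by the substructure relation. -/
def ofHereditary (Φ : ∀ (M : Type u) [L.Structure M], Prop)
    (hsub : ∀ {M N : Type u} [L.Structure M] [L.Structure N] (_ : M ↪[L] N), Φ N → Φ M)
    (hchain : ∀ {N : Type u} [L.Structure N] {ι : Type u} [LinearOrder ι]
      (S : ι → L.Substructure N), Monotone S → (∀ x : N, ∃ i, x ∈ S i) → (∀ i, Φ (S i)) → Φ N) :
    AEC L where
  Mem M _ := Nonempty M ∧ Φ M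
  IsStrong {M N} _ _ _ := (Nonempty M ∧ Φ M) ∧ (Nonempty N ∧ Φ N)
  nonempty_of_mem h := h.1
  mem_of_isStrong _ h := h
  mem_of_equiv e h := ⟨h.1.map e, hsub e.symm.toEmbedding h.2⟩
  isStrong_equiv e h := ⟨h, h.1.map e, hsub e.symm.toEmbedding h.2⟩
  isStrong_comp _ _ h₁ h₂ := ⟨h₁.1, h₂.2⟩
  coherence _ _ h₁ h₂ := ⟨h₁.1, h₂.1⟩
  chain := by
    intro N _ ι _ _ hι S hS hcov hmem _
    obtain ⟨i₀⟩ := hι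
    have hN : Nonempty N ∧ Φ N :=
      ⟨(hmem i₀).1.map Subtype.val, hchain S hS hcov fun i => (hmem i).2⟩
    exact ⟨hN, fun i => ⟨hmem i, hN⟩, fun f hP _ => ⟨hN, hP⟩⟩
  exists_ls := by
    refine ⟨max ℵ₀ L.card, le_max_left _ _, le_max_right _ _, fun {M} _ hM X => ?_⟩
    have := hM.1
    obtain ⟨S, hX, hS, hc⟩ := exists_substructure_card_le (L := L) X
    exact ⟨S, hX, ⟨⟨hS, hsub S.subtype hM.2⟩, hM⟩, hc⟩

section Hereditary

variable {K : AEC L}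

/-- `K` is closed under nonempty substructures and ordered by the substructure relation. -/
def IsHereditary (K : AEC L) : Prop :=
  ∀ {M N : Type u} [L.Structure M] [L.Structure N] (f : M ↪[L] N), Nonempty M → K.Mem N →
    K.IsStrong f

theorem ofHereditary_isHereditary (Φ : ∀ (M : Type u) [L.Structure M], Prop) (hsub) (hchain) :
    (ofHereditary (L := L) Φ hsub hchain).IsHereditary :=
  fun f hM hN => ⟨⟨hM, hsub f hN.2⟩, hN⟩

/-- Generating a nonempty substructure already gives a strong one, so nothing beyond the lower
bounds built into the definition of `LS` is needed. -/
theorem IsHereditary.LS_eq (hK : K.IsHereditary) : K.LS = max ℵ₀ L.card := by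
  refine le_antisymm (csInf_le (OrderBot.bddBelow _) ?_) (le_csInf ?_ ?_)
  · refine ⟨le_max_left _ _, le_max_right _ _, fun {M} _ hM X => ?_⟩
    have := K.nonempty_of_mem hM
    obtain ⟨S, hX, hS, hc⟩ := exists_substructure_card_le (L := L) X
    exact ⟨S, hX, hK _ hS hM, hc⟩
  · exact K.exists_ls
  · rintro κ ⟨h₁, h₂, -⟩
    exact max_le h₁ h₂

/-- In a hereditary class, an embedding of a substructure containing `A` and `a` which carries them
to the base and tuple of another triple witnesses equality of Galois types. -/
theorem IsHereditary.quot_mk_eq (hK : K.IsHereditary) {I : Type} {A : Type u}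
    (p q : K.PreType I A) (S : L.Substructure p.M) (hne : Nonempty S)
    (hA : ∀ x, p.base x ∈ S) (hI : ∀ i, p.tuple i ∈ S) (f : S ↪[L] q.M)
    (hfA : ∀ x, f ⟨p.base x, hA x⟩ = q.base x) (hfI : ∀ i, f ⟨p.tuple i, hI i⟩ = q.tuple i) :
    (Quot.mk _ p : K.GaloisType I A) = Quot.mk _ q := by
  have hS := (K.mem_of_isStrong _ (hK S.subtype hne p.mem)).1
  let r : K.PreType I A :=
    { M := S, mem := hS, tuple := fun i => ⟨p.tuple i, hI i⟩
      base := ⟨fun x => ⟨p.base x, hA x⟩, fun x y h => p.base.injective (congrArg Subtype.val h)⟩ }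
  have h₁ : PreType.AtomicEq r p :=
    ⟨p.M, p.str, S.subtype, FirstOrder.Language.Embedding.refl L p.M, hK _ hne p.mem,
      hK _ (K.nonempty_of_mem p.mem) p.mem, fun _ => rfl, fun _ => rfl⟩
  have h₂ : PreType.AtomicEq r q :=
    ⟨q.M, q.str, f, FirstOrder.Language.Embedding.refl L q.M, hK _ hne q.mem,
      hK _ (K.nonempty_of_mem q.mem) q.mem, hfA, hfI⟩
  exact (Quot.sound h₁).symm.trans (Quot.sound h₂)

/-- The elements of a triple `(a, A, M)` as one family. -/
def PreType.elems {I : Type} {A : Type u} (p : K.PreType I A) : A ⊕ ULift.{u} I → p.M :=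
  Sum.elim p.base fun i => p.tuple i.down

/-- Embeddings preserve atomic types, and both triples have the same image in the common extension.
The atomic type is therefore an invariant of the Galois type. -/
theorem PreType.AtomicEq.atomicType_eq {I : Type} {A : Type u} {p q : K.PreType I A}
    (h : p.AtomicEq q) : L.atomicType p.elems = L.atomicType q.elems := by
  obtain ⟨P, _, f, g, -, -, hA, hI⟩ := h
  rw [← FirstOrder.Language.atomicType_comp f, ← FirstOrder.Language.atomicType_comp g]
  congr 1
  funext i
  rcases i with x | i
  · exact hA x
  · exact hI i.down

theorem atomicType_eq_of_quot_mk_eq {I : Type} {A : Type u} {p q : K.PreType I A}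
    (h : (Quot.mk _ p : K.GaloisType I A) = Quot.mk _ q) :
    L.atomicType p.elems = L.atomicType q.elems :=
  congrArg (Quot.lift (fun r : K.PreType I A => L.atomicType r.elems)
    fun _ _ h => h.atomicType_eq) h

/-- The substructure generated by the triple `p` is a common submodel of both models. Nonemptiness
of `A ⊕ I` is needed because the substructure generated by nothing may be empty, hence not a model.
-/
theorem IsHereditary.quot_mk_eq_of_atomicType_eq (hK : K.IsHereditary) {I : Type} {A : Type u}
    (hne : Nonempty (A ⊕ I)) {p q : K.PreType I A}
    (h : L.atomicType p.elems = L.atomicType q.elems) :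
    (Quot.mk _ p : K.GaloisType I A) = Quot.mk _ q := by
  obtain ⟨f, hf⟩ := FirstOrder.Language.exists_embedding_of_atomicType_eq h
  have hmem : ∀ i, p.elems i ∈ Substructure.closure L (Set.range p.elems) :=
    fun i => Substructure.subset_closure ⟨i, rfl⟩
  refine hK.quot_mk_eq p q _ ?_ (fun x => hmem (Sum.inl x)) (fun i => hmem (Sum.inr ⟨i⟩)) f
    (fun x => hf (Sum.inl x)) fun i => hf (Sum.inr ⟨i⟩)
  rcases hne with ⟨x | i⟩
  · exact ⟨⟨_, hmem (Sum.inl x)⟩⟩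
  · exact ⟨⟨_, hmem (Sum.inr ⟨i⟩)⟩⟩

/-- An equation or atomic formula mentions only finitely many parameters from `A`; restrict to
those. -/
theorem atomicType_eq_of_forall_finite {I : Type} {A : Type u} {p q : K.PreType I A}
    (h : ∀ A₀ : Set A, A₀.Finite →
      L.atomicType (p.restrict A₀).elems = L.atomicType (q.restrict A₀).elems) :
    L.atomicType p.elems = L.atomicType q.elems := by
  classical
  have key : ∀ (r : K.PreType I A) (A₀ : Set A) (t : L.Term (A ⊕ ULift.{u} I))
      (ht : ↑t.varFinsetLeft ⊆ A₀),
      (t.restrictVarLeft (Set.inclusion ht)).realize (r.restrict A₀).elems = t.realize r.elems :=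
    fun r A₀ t ht => Term.realize_restrictVarLeft' ht (v := r.base)
      (xs := fun i : ULift.{u} I => r.tuple i.down)
  rw [FirstOrder.Language.atomicType_eq_iff]
  constructor
  · intro s t
    have h₀ := (FirstOrder.Language.atomicType_eq_iff.1
      (h (s.varFinsetLeft ∪ t.varFinsetLeft : Finset A) (Finset.finite_toSet _))).1
      (s.restrictVarLeft (Set.inclusion (by simp)))
      (t.restrictVarLeft (Set.inclusion (by simp)))
    rwa [key, key, key, key] at h₀
  · intro n R ts
    have hts : ∀ i, (↑(ts i).varFinsetLeft : Set A) ⊆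
        (Finset.univ.biUnion fun i => (ts i).varFinsetLeft : Finset A) := fun i =>
      Finset.coe_subset.2 (Finset.subset_biUnion_of_mem (fun i => (ts i).varFinsetLeft)
        (Finset.mem_univ i))
    have h₀ := (FirstOrder.Language.atomicType_eq_iff.1
      (h (Finset.univ.biUnion fun i => (ts i).varFinsetLeft : Finset A)
        (Finset.finite_toSet _))).2 n R
      fun i => (ts i).restrictVarLeft (Set.inclusion (hts i))
    simp only [key] at h₀
    exact h₀

/-- Hereditary classes with joint embedding are `(< ℵ₀)`-tame. -/
theorem IsHereditary.tame (hK : K.IsHereditary) (hJ : K.JEP) : K.Tame ℵ₀ := by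
  intro A n _ p q
  induction p using Quot.ind with | _ p
  induction q using Quot.ind with | _ q
  contrapose!
  intro h
  by_cases hne : Nonempty (A ⊕ Fin n)
  · refine hK.quot_mk_eq_of_atomicType_eq hne (atomicType_eq_of_forall_finite fun A₀ hA₀ => ?_)
    exact atomicType_eq_of_quot_mk_eq (h A₀ (Cardinal.lt_aleph0_iff_set_finite.2 hA₀))
  -- With no parameters and an empty tuple, joint embedding makes all types equal.
  · have hE := not_nonempty_iff.1 hne
    obtain ⟨P, _, f, g, hf, hg⟩ := hJ p.mem q.mem
    exact Quot.sound ⟨P, _, f, g, hf, hg, fun x => hE.elim (Sum.inl x), fun i => hE.elim (Sum.inr i)⟩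

end Hereditary

end AEC

/-! ### Disjoint unions of well-founded extensional structures of bounded rank -/

namespace RankedSets

/-- The function symbols: a binary symbol for a witness of extensionality. -/
inductive Fn : ℕ → Type u
  | wit : Fn 2

/-- The relation symbols: unary predicates coding the rank of an element, an equivalence relation,
a membership relation and one more binary relation. -/
inductive Rl (I : Type u) : ℕ → Type u
  | lev : I → Rl I 1
  | eqv : Rl I 2
  | mem : Rl I 2
  | ord : Rl I 2

/-- The language with symbols `Fn` and `Rl I`. -/
abbrev lang (I : Type u) : FirstOrder.Language.{u, u} := ⟨Fn, Rl I⟩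

theorem max_aleph0_card_lang {I : Type u} (hI : ℵ₀ ≤ #I) : max ℵ₀ (lang I).card = #I := by
  apply le_antisymm
  · refine max_le hI ?_
    let g : I ⊕ ULift.{u} (Fin 4) → (lang I).Symbols
      | .inl i => .inr ⟨1, Rl.lev i⟩
      | .inr ⟨0⟩ => .inr ⟨2, Rl.eqv⟩
      | .inr ⟨1⟩ => .inr ⟨2, Rl.mem⟩
      | .inr ⟨2⟩ => .inr ⟨2, Rl.ord⟩
      | .inr ⟨3⟩ => .inl ⟨2, Fn.wit⟩
    have hg : Function.Surjective g := by
      rintro (⟨_, ⟨⟩⟩ | ⟨_, (i | _ | _ | _)⟩)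
      · exact ⟨.inr ⟨3⟩, rfl⟩
      · exact ⟨.inl i, rfl⟩
      · exact ⟨.inr ⟨0⟩, rfl⟩
      · exact ⟨.inr ⟨1⟩, rfl⟩
      · exact ⟨.inr ⟨2⟩, rfl⟩
    refine (Cardinal.mk_le_of_surjective hg).trans ?_
    rw [Cardinal.mk_sum]
    refine Cardinal.add_le_of_le hI (by simp) ?_
    refine le_trans ?_ hI
    simp
  · refine le_max_of_le_right ?_
    refine Cardinal.mk_le_of_injective (f := fun i : I => (.inr ⟨1, Rl.lev i⟩ : (lang I).Symbols))
      fun i j h => ?_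
    simp at h
    exact h

section Basic

variable {I : Type u} {M N : Type u} [(lang I).Structure M] [(lang I).Structure N]

/-- The unary predicates. -/
def lev (i : I) (x : M) : Prop := RelMap (L := lang I) (Rl.lev i) ![x]

variable (I)

/-- The equivalence relation. -/
def eqv (x y : M) : Prop := RelMap (L := lang I) Rl.eqv ![x, y]

/-- The membership relation: `mem I x y` says that `x` is a member of `y`. -/
def mem (x y : M) : Prop := RelMap (L := lang I) Rl.mem ![x, y]

/-- The remaining binary relation. -/
def ord (x y : M) : Prop := RelMap (L := lang I) Rl.ord ![x, y]

/-- The witness of extensionality. -/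
def wit (x y : M) : M := funMap (L := lang I) Fn.wit ![x, y]

/-- A structure given by its predicates and its witness function. -/
@[reducible] def mkStr {M : Type u} (P : I → M → Prop) (E m o : M → M → Prop) (w : M → M → M) :
    (lang I).Structure M where
  funMap {_} f v := match f, v with
    | Fn.wit, v => w (v 0) (v 1)
  RelMap {_} r v := match r, v with
    | Rl.lev i, v => P i (v 0)
    | Rl.eqv, v => E (v 0) (v 1)
    | Rl.mem, v => m (v 0) (v 1)
    | Rl.ord, v => o (v 0) (v 1)

variable {I}

theorem eq_vec_one {X : Type u} (v : Fin 1 → X) : v = ![v 0] := by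
  funext i; fin_cases i; rfl

theorem eq_vec_two {X : Type u} (v : Fin 2 → X) : v = ![v 0, v 1] := by
  funext i; fin_cases i <;> rfl

theorem comp_vec_one {X Y : Type u} (f : X → Y) (x : X) : f ∘ ![x] = ![f x] := by
  funext i; fin_cases i; rfl

theorem comp_vec_two {X Y : Type u} (f : X → Y) (x y : X) : f ∘ ![x, y] = ![f x, f y] := by
  funext i; fin_cases i <;> rfl

/-- An embedding given by a function which preserves the predicates and the witness function. -/
def mkEmb (f : M → N) (hf : Function.Injective f)
    (hw : ∀ x y, f (wit I x y) = wit I (f x) (f y))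
    (hl : ∀ (i : I) x, lev i (f x) ↔ lev i x) (hE : ∀ x y, eqv I (f x) (f y) ↔ eqv I x y)
    (hm : ∀ x y, mem I (f x) (f y) ↔ mem I x y) (ho : ∀ x y, ord I (f x) (f y) ↔ ord I x y) :
    M ↪[lang I] N where
  toFun := f
  inj' := hf
  map_fun' {_} F v := by
    cases F
    rw [eq_vec_two v, comp_vec_two]
    exact hw _ _
  map_rel' {_} r v := by
    cases r
    · rw [eq_vec_one v, comp_vec_one]; exact hl _ _
    · rw [eq_vec_two v, comp_vec_two]; exact hE _ _
    · rw [eq_vec_two v, comp_vec_two]; exact hm _ _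
    · rw [eq_vec_two v, comp_vec_two]; exact ho _ _

theorem lev_map (f : M ↪[lang I] N) (i : I) (x : M) : lev i (f x) ↔ lev i x := by
  unfold lev; rw [← comp_vec_one f]; exact f.map_rel _ _

theorem eqv_map (f : M ↪[lang I] N) (x y : M) : eqv I (f x) (f y) ↔ eqv I x y := by
  unfold eqv; rw [← comp_vec_two f]; exact f.map_rel _ _

theorem mem_map (f : M ↪[lang I] N) (x y : M) : mem I (f x) (f y) ↔ mem I x y := by
  unfold mem; rw [← comp_vec_two f]; exact f.map_rel _ _

theorem ord_map (f : M ↪[lang I] N) (x y : M) : ord I (f x) (f y) ↔ ord I x y := by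
  unfold ord; rw [← comp_vec_two f]; exact f.map_rel _ _

theorem wit_map (f : M ↪[lang I] N) (x y : M) : wit I (f x) (f y) = f (wit I x y) := by
  unfold wit; rw [← comp_vec_two f]; exact (f.map_fun _ _).symm

theorem wit_mem (S : (lang I).Substructure M) {x y : M} (hx : x ∈ S) (hy : y ∈ S) :
    wit I x y ∈ S := by
  have := (wit I (⟨x, hx⟩ : S) ⟨y, hy⟩).2
  have h := wit_map S.subtype ⟨x, hx⟩ ⟨y, hy⟩
  exact h ▸ this

/-- The substructure on a set closed under the witness function. -/
def mkSub (s : Set M) (hs : ∀ x ∈ s, ∀ y ∈ s, wit I x y ∈ s) : (lang I).Substructure M where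
  carrier := s
  fun_mem {_} F v hv := by
    cases F
    rw [eq_vec_two v]
    exact hs _ (hv 0) _ (hv 1)

variable (c : Ordinal.{u} → Set I) (β : Ordinal.{u})

/-- `x` has rank `o < β`, coded by the set `c o`. -/
def HasLevel (x : M) (o : Ordinal.{u}) : Prop := o < β ∧ ∀ i, lev i x ↔ i ∈ c o

theorem hasLevel_map (f : M ↪[lang I] N) (x : M) (o : Ordinal.{u}) :
    HasLevel c β (f x) o ↔ HasLevel c β x o := by
  simp only [HasLevel, lev_map f]

variable (M)

/-- Disjoint unions (with classes given by `eqv`) of extensional structures in which membership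
lowers the rank, which is an ordinal below `β`. -/
structure Good : Prop where
  refl : ∀ x : M, eqv I x x
  symm : ∀ x y : M, eqv I x y → eqv I y x
  trans : ∀ x y z : M, eqv I x y → eqv I y z → eqv I x z
  lev : ∀ x : M, ∃ o, HasLevel c β x o
  mem_eqv : ∀ x y : M, mem I x y → eqv I x y
  ord_eqv : ∀ x y : M, ord I x y → eqv I x y
  mem_lt : ∀ x y : M, mem I x y → ∀ v w, HasLevel c β x v → HasLevel c β y w → v < w
  wit_eqv : ∀ x y : M, eqv I x (wit I x y)
  wit_eq : ∀ x y : M, ¬ eqv I x y → wit I x y = x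
  ext : ∀ x y : M, eqv I x y → x ≠ y → ¬ (mem I (wit I x y) x ↔ mem I (wit I x y) y)

variable {M c β}

theorem Good.of_embedding (f : M ↪[lang I] N) (h : Good N c β) : Good M c β where
  refl x := (eqv_map f _ _).1 (h.refl _)
  symm x y := by simpa only [eqv_map f] using h.symm (f x) (f y)
  trans x y z := by simpa only [eqv_map f] using h.trans (f x) (f y) (f z)
  lev x := by simpa only [hasLevel_map] using h.lev (f x)
  mem_eqv x y := by simpa only [eqv_map f, mem_map f] using h.mem_eqv (f x) (f y)
  ord_eqv x y := by simpa only [eqv_map f, ord_map f] using h.ord_eqv (f x) (f y)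
  mem_lt x y := by simpa only [hasLevel_map, mem_map f] using h.mem_lt (f x) (f y)
  wit_eqv x y := by simpa only [wit_map f, eqv_map f] using h.wit_eqv (f x) (f y)
  wit_eq x y := by
    simpa only [wit_map f, eqv_map f, f.injective.eq_iff] using h.wit_eq (f x) (f y)
  ext x y := by
    simpa only [wit_map f, eqv_map f, mem_map f, ne_eq, f.injective.eq_iff] using h.ext (f x) (f y)

/-- Every axiom speaks of at most three elements, so it can be checked in a substructure containing
them. This gives closure under unions of chains. -/
theorem Good.of_local (h : ∀ x y z : M, ∃ S : (lang I).Substructure M,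
    Good S c β ∧ x ∈ Set.range S.subtype ∧ y ∈ Set.range S.subtype ∧
      z ∈ Set.range S.subtype) : Good M c β where
  refl x := by
    obtain ⟨S, hS, ⟨x, rfl⟩, -, -⟩ := h x x x
    simpa only [eqv_map S.subtype] using hS.refl x
  symm x y := by
    obtain ⟨S, hS, ⟨x, rfl⟩, ⟨y, rfl⟩, -⟩ := h x y y
    simpa only [eqv_map S.subtype] using hS.symm x y
  trans x y z := by
    obtain ⟨S, hS, ⟨x, rfl⟩, ⟨y, rfl⟩, ⟨z, rfl⟩⟩ := h x y z
    simpa only [eqv_map S.subtype] using hS.trans x y z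
  lev x := by
    obtain ⟨S, hS, ⟨x, rfl⟩, -, -⟩ := h x x x
    simpa only [hasLevel_map c β S.subtype] using hS.lev x
  mem_eqv x y := by
    obtain ⟨S, hS, ⟨x, rfl⟩, ⟨y, rfl⟩, -⟩ := h x y y
    simpa only [eqv_map S.subtype, mem_map S.subtype] using hS.mem_eqv x y
  ord_eqv x y := by
    obtain ⟨S, hS, ⟨x, rfl⟩, ⟨y, rfl⟩, -⟩ := h x y y
    simpa only [eqv_map S.subtype, ord_map S.subtype] using hS.ord_eqv x y
  mem_lt x y := by
    obtain ⟨S, hS, ⟨x, rfl⟩, ⟨y, rfl⟩, -⟩ := h x y y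
    simpa only [hasLevel_map c β S.subtype, mem_map S.subtype] using
      hS.mem_lt x y
  wit_eqv x y := by
    obtain ⟨S, hS, ⟨x, rfl⟩, ⟨y, rfl⟩, -⟩ := h x y y
    simpa only [eqv_map S.subtype, wit_map S.subtype] using hS.wit_eqv x y
  wit_eq x y := by
    obtain ⟨S, hS, ⟨x, rfl⟩, ⟨y, rfl⟩, -⟩ := h x y y
    simpa only [eqv_map S.subtype, wit_map S.subtype, S.subtype.injective.eq_iff] using
      hS.wit_eq x y
  ext x y := by
    obtain ⟨S, hS, ⟨x, rfl⟩, ⟨y, rfl⟩, -⟩ := h x y y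
    simpa only [eqv_map S.subtype, mem_map S.subtype, wit_map S.subtype, ne_eq,
      S.subtype.injective.eq_iff] using hS.ext x y

variable (c β) in
/-- The class of nonempty disjoint unions of extensional structures of rank at most `β`. -/
def cls : AEC (lang I) :=
  AEC.ofHereditary (fun M _ => Good M c β) (fun f h => h.of_embedding f) (by
    intro N _ ι _ S hS hcov h
    refine Good.of_local fun x y z => ?_
    obtain ⟨i, hi⟩ := hcov x
    obtain ⟨j, hj⟩ := hcov y
    obtain ⟨k, hk⟩ := hcov z
    exact ⟨S (max i (max j k)), h _, ⟨⟨x, hS (le_max_left _ _) hi⟩, rfl⟩,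
      ⟨⟨y, hS ((le_max_left _ _).trans (le_max_right _ _)) hj⟩, rfl⟩,
      ⟨⟨z, hS ((le_max_right _ _).trans (le_max_right _ _)) hk⟩, rfl⟩⟩)

theorem cls_isHereditary : (cls c β).IsHereditary := AEC.ofHereditary_isHereditary _ _ _

end Basic

/-! ### Disjoint unions: joint embedding and no maximal models. -/

section Sum

variable {I : Type u} {c : Ordinal.{u} → Set I} {β : Ordinal.{u}}
  {M N : Type u} [(lang I).Structure M] [(lang I).Structure N]

/-- The disjoint union of two structures. -/
instance : (lang I).Structure (M ⊕ N) :=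
  mkStr I (fun i => Sum.elim (lev i) (lev i)) (Sum.LiftRel (eqv I) (eqv I))
    (Sum.LiftRel (mem I) (mem I)) (Sum.LiftRel (ord I) (ord I))
    (fun a b => match a, b with
      | .inl x, .inl y => .inl (wit I x y)
      | .inr x, .inr y => .inr (wit I x y)
      | a, _ => a)

variable (M N) in
/-- The embedding of the left summand. -/
def inlEmb : M ↪[lang I] M ⊕ N :=
  mkEmb Sum.inl Sum.inl_injective (fun _ _ => rfl) (fun _ _ => Iff.rfl)
    (fun _ _ => Sum.liftRel_inl_inl) (fun _ _ => Sum.liftRel_inl_inl)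
    fun _ _ => Sum.liftRel_inl_inl

variable (M N) in
/-- The embedding of the right summand. -/
def inrEmb : N ↪[lang I] M ⊕ N :=
  mkEmb Sum.inr Sum.inr_injective (fun _ _ => rfl) (fun _ _ => Iff.rfl)
    (fun _ _ => Sum.liftRel_inr_inr) (fun _ _ => Sum.liftRel_inr_inr)
    fun _ _ => Sum.liftRel_inr_inr

theorem Good.sum (hM : Good M c β) (hN : Good N c β) : Good (M ⊕ N) c β := by
  have e₁ : ∀ {x y : M}, eqv I (.inl x : M ⊕ N) (.inl y) ↔ eqv I x y := eqv_map (inlEmb M N) _ _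
  have e₂ : ∀ {x y : N}, eqv I (.inr x : M ⊕ N) (.inr y) ↔ eqv I x y := eqv_map (inrEmb M N) _ _
  have e₃ : ∀ {x : M} {y : N}, ¬ eqv I (.inl x : M ⊕ N) (.inr y) := Sum.not_liftRel_inl_inr
  have e₄ : ∀ {x : M} {y : N}, ¬ eqv I (.inr y : M ⊕ N) (.inl x) := Sum.not_liftRel_inr_inl
  have m₁ : ∀ {x y : M}, mem I (.inl x : M ⊕ N) (.inl y) ↔ mem I x y := mem_map (inlEmb M N) _ _
  have m₂ : ∀ {x y : N}, mem I (.inr x : M ⊕ N) (.inr y) ↔ mem I x y := mem_map (inrEmb M N) _ _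
  have m₃ : ∀ {x : M} {y : N}, ¬ mem I (.inl x : M ⊕ N) (.inr y) := Sum.not_liftRel_inl_inr
  have m₄ : ∀ {x : M} {y : N}, ¬ mem I (.inr y : M ⊕ N) (.inl x) := Sum.not_liftRel_inr_inl
  have o₁ : ∀ {x y : M}, ord I (.inl x : M ⊕ N) (.inl y) ↔ ord I x y := ord_map (inlEmb M N) _ _
  have o₂ : ∀ {x y : N}, ord I (.inr x : M ⊕ N) (.inr y) ↔ ord I x y := ord_map (inrEmb M N) _ _
  have o₃ : ∀ {x : M} {y : N}, ¬ ord I (.inl x : M ⊕ N) (.inr y) := Sum.not_liftRel_inl_inr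
  have o₄ : ∀ {x : M} {y : N}, ¬ ord I (.inr y : M ⊕ N) (.inl x) := Sum.not_liftRel_inr_inl
  have l₁ : ∀ {x : M} {o}, HasLevel c β (.inl x : M ⊕ N) o ↔ HasLevel c β x o :=
    hasLevel_map c β (inlEmb M N) _ _
  have l₂ : ∀ {x : N} {o}, HasLevel c β (.inr x : M ⊕ N) o ↔ HasLevel c β x o :=
    hasLevel_map c β (inrEmb M N) _ _
  have w₁ : ∀ {x y : M}, wit I (.inl x : M ⊕ N) (.inl y) = .inl (wit I x y) :=
    wit_map (inlEmb M N) _ _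
  have w₂ : ∀ {x y : N}, wit I (.inr x : M ⊕ N) (.inr y) = .inr (wit I x y) :=
    wit_map (inrEmb M N) _ _
  have w₃ : ∀ {x : M} {y : N}, wit I (.inl x : M ⊕ N) (.inr y) = .inl x := rfl
  have w₄ : ∀ {x : M} {y : N}, wit I (.inr y : M ⊕ N) (.inl x) = .inr y := rfl
  constructor
  case refl => rintro (x | x) <;> simp only [e₁, e₂, hM.refl, hN.refl]
  case symm =>
    rintro (x | x) (y | y) <;> simp only [e₁, e₂, e₃, e₄, false_imp_iff]
    exacts [hM.symm x y, hN.symm x y]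
  case trans =>
    rintro (x | x) (y | y) (z | z) <;> simp only [e₁, e₂, e₃, e₄, false_imp_iff, imp_false,
      not_false_eq_true, imp_true_iff]
    exacts [hM.trans x y z, hN.trans x y z]
  case lev =>
    rintro (x | x) <;> simp only [l₁, l₂]
    exacts [hM.lev x, hN.lev x]
  case mem_eqv =>
    rintro (x | x) (y | y) <;> simp only [e₁, e₂, m₁, m₂, m₃, m₄, false_imp_iff]
    exacts [hM.mem_eqv x y, hN.mem_eqv x y]
  case ord_eqv =>
    rintro (x | x) (y | y) <;> simp only [e₁, e₂, o₁, o₂, o₃, o₄, false_imp_iff]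
    exacts [hM.ord_eqv x y, hN.ord_eqv x y]
  case mem_lt =>
    rintro (x | x) (y | y) <;> simp only [l₁, l₂, m₁, m₂, m₃, m₄, false_imp_iff]
    exacts [hM.mem_lt x y, hN.mem_lt x y]
  case wit_eqv =>
    rintro (x | x) (y | y) <;> simp only [w₁, w₂, w₃, w₄, e₁, e₂]
    exacts [hM.wit_eqv x y, hM.refl x, hN.refl x, hN.wit_eqv x y]
  case wit_eq =>
    rintro (x | x) (y | y) <;>
      simp only [w₁, w₂, w₃, w₄, e₁, e₂, Sum.inl.injEq, Sum.inr.injEq, imp_true_iff]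
    exacts [hM.wit_eq x y, hN.wit_eq x y]
  case ext =>
    rintro (x | x) (y | y) <;>
      simp only [w₁, w₂, e₁, e₂, e₃, e₄, m₁, m₂, ne_eq, Sum.inl.injEq, Sum.inr.injEq,
        false_imp_iff]
    exacts [hM.ext x y, hN.ext x y]

theorem cls_jep : (cls c β).JEP := by
  intro M N _ _ hM hN
  have hmem : (cls c β).Mem (M ⊕ N) := ⟨hM.1.map Sum.inl, hM.2.sum hN.2⟩
  exact ⟨M ⊕ N, _, inlEmb M N, inrEmb M N, cls_isHereditary _ hM.1 hmem,
    cls_isHereditary _ hN.1 hmem⟩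

theorem cls_nmm : (cls c β).NMM := by
  intro M _ hM
  have hmem : (cls c β).Mem (M ⊕ M) := ⟨hM.1.map Sum.inl, hM.2.sum hM.2⟩
  refine ⟨M ⊕ M, _, inlEmb M M, cls_isHereditary _ hM.1 hmem, fun h => ?_⟩
  obtain ⟨m⟩ := hM.1
  obtain ⟨x, hx⟩ := h (Sum.inr m)
  exact Sum.inl_ne_inr hx

end Sum

/-! ### Mostowski collapse and the bound on components. -/

section Collapse

variable {I : Type u} {c : Ordinal.{u} → Set I} {β : Ordinal.{u}}
  {M : Type u} [(lang I).Structure M]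

theorem Good.wellFounded (h : Good M c β) : WellFounded (mem I (M := M)) := by
  choose l hl using h.lev
  exact Subrelation.wf (fun {x y} hxy => h.mem_lt x y hxy _ _ (hl x) (hl y))
    (InvImage.wf l Ordinal.lt_wf)

/-- The Mostowski collapse. -/
noncomputable def collapse (h : Good M c β) : M → ZFSet.{u} :=
  h.wellFounded.fix fun x ih => ZFSet.range fun y : {y // mem I y x} => ih y.1 y.2

theorem mem_collapse (h : Good M c β) {x : M} {z : ZFSet.{u}} :
    z ∈ collapse h x ↔ ∃ y, mem I y x ∧ collapse h y = z := by
  rw [collapse, WellFounded.fix_eq, ZFSet.mem_range]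
  simp only [Subtype.exists, exists_prop]

/-- Only an inequality holds: the coded rank of `x` may exceed what its members present in `M`
account for. -/
theorem rank_collapse_le (h : Good M c β) (x : M) {o : Ordinal.{u}} (ho : HasLevel c β x o) :
    (collapse h x).rank ≤ o := by
  induction x using h.wellFounded.induction generalizing o with
  | _ x ih =>
    rw [ZFSet.rank_le_iff]
    intro z hz
    obtain ⟨y, hy, rfl⟩ := (mem_collapse h).1 hz
    obtain ⟨v, hv⟩ := h.lev y
    exact (ih y hy hv).trans_lt (h.mem_lt y x hy v o hv ho)

theorem collapse_mem_vonNeumann (h : Good M c β) (x : M) : collapse h x ∈ ZFSet.vonNeumann β := by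
  obtain ⟨o, ho⟩ := h.lev x
  exact ZFSet.mem_vonNeumann.2 ((rank_collapse_le h x ho).trans_lt ho.1)

/-- Induction on membership. If `x ≠ y`, the witness belongs to exactly one of them. Equality of
collapses gives a member of the other with the same collapse, in the same component, and by
induction that member is the witness itself. -/
theorem collapse_injective (h : Good M c β) (x y : M) (hxy : eqv I x y)
    (hc : collapse h x = collapse h y) : x = y := by
  induction x using h.wellFounded.induction generalizing y with
  | _ x ih =>
    by_contra hne
    have hext := h.ext x y hxy hne
    generalize wit I x y = z at hext
    by_cases hz : mem I z x
    · obtain ⟨z', hz', he⟩ := (mem_collapse h).1 (hc ▸ (mem_collapse h).2 ⟨z, hz, rfl⟩)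
      have : z = z' := ih z hz z' (h.trans _ _ _ (h.trans _ _ _ (h.mem_eqv _ _ hz) hxy)
        (h.symm _ _ (h.mem_eqv _ _ hz'))) he.symm
      subst this
      exact hext (iff_of_true hz hz')
    · have hzy : mem I z y := by
        by_contra hzy
        exact hext (iff_of_false hz hzy)
      obtain ⟨z', hz', he⟩ := (mem_collapse h).1 (hc ▸ (mem_collapse h).2 ⟨z, hzy, rfl⟩)
      have : z' = z := ih z' hz' z (h.trans _ _ _ (h.trans _ _ _ (h.mem_eqv _ _ hz') hxy)
        (h.symm _ _ (h.mem_eqv _ _ hzy))) he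
      exact hz (this ▸ hz')

/-- The collapse is injective on a component and takes values in `V_β`. The bound does not depend on
`M`. -/
theorem Good.mk_class_le (h : Good M c β) (x : M) :
    #{y | eqv I x y} ≤ (ZFSet.vonNeumann β).card := by
  refine Cardinal.mk_le_of_injective
    (f := fun y => equivShrink _ ⟨collapse h y.1, collapse_mem_vonNeumann h y.1⟩) fun y z hyz => ?_
  have := congrArg Subtype.val ((equivShrink _).injective hyz)
  exact Subtype.ext (collapse_injective h _ _ (h.trans _ _ _ (h.symm _ _ y.2) z.2) this)

end Collapse

/-! ### Stability. -/

section Stability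

variable {I : Type u} {c : Ordinal.{u} → Set I} {β : Ordinal.{u}}
  {M : Type u} [(lang I).Structure M]

/-- The union of the classes which meet `A`. -/
def saturation (I : Type u) {M : Type u} [(lang I).Structure M] (A : Set M) : Set M :=
  ⋃ a : A, {y | eqv I a.1 y}

theorem mem_saturation {A : Set M} {y : M} : y ∈ saturation I A ↔ ∃ a ∈ A, eqv I a y := by
  simp [saturation]

theorem Good.saturation_iff (h : Good M c β) {A : Set M} {x y : M} (hxy : eqv I x y) :
    x ∈ saturation I A ↔ y ∈ saturation I A := by
  simp only [mem_saturation]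
  exact ⟨fun ⟨a, ha, hx⟩ => ⟨a, ha, h.trans _ _ _ hx hxy⟩,
    fun ⟨a, ha, hy⟩ => ⟨a, ha, h.trans _ _ _ hy (h.symm _ _ hxy)⟩⟩

/-- The value of `wit` stays in the component of its first argument, so one element generates inside
its own component. -/
theorem Good.eqv_of_mem_closure (h : Good M c β) {v : ULift.{u} (Fin 1) → M} {x : M}
    (hx : x ∈ Substructure.closure (lang I) (Set.range v)) : eqv I (v ⟨0⟩) x := by
  have : Substructure.closure (lang I) (Set.range v) ≤
      mkSub {y | eqv I (v ⟨0⟩) y} (fun y hy z _ => h.trans _ _ _ hy (h.wit_eqv y z)) := by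
    rw [Substructure.closure_le]
    rintro _ ⟨⟨i⟩, rfl⟩
    rw [Subsingleton.elim i 0]
    exact h.refl _
  exact this hx

/-- The Galois type over `A` of an element whose class does not meet `A` is determined by its
atomic type over the empty set. -/
theorem gtp_eq_of_notMem_saturation (hM : (cls c β).Mem M) {A : Set M} {a b : Fin 1 → M}
    (ha : a 0 ∉ saturation I A) (hb : b 0 ∉ saturation I A)
    (hab : (lang I).atomicType (fun i : ULift.{u} (Fin 1) => a i.down) =
      (lang I).atomicType fun i : ULift.{u} (Fin 1) => b i.down) :
    (cls c β).gtp hM A a = (cls c β).gtp hM A b := by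
  classical
  have h : Good M c β := hM.2
  set D := saturation I A
  let C := Substructure.closure (lang I) (Set.range fun i : ULift.{u} (Fin 1) => a i.down)
  have haC : ∀ i, a i ∈ C := fun i => Substructure.subset_closure ⟨⟨i⟩, rfl⟩
  obtain ⟨g, hg⟩ : ∃ g : C ↪[lang I] M, ∀ i, g ⟨a i, haC i⟩ = b i := by
    obtain ⟨g, hg⟩ := FirstOrder.Language.exists_embedding_of_atomicType_eq hab
    exact ⟨g, fun i => hg ⟨i⟩⟩
  have hCa : ∀ {x}, x ∈ C → eqv I (a 0) x := fun hx => h.eqv_of_mem_closure hx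
  have hCD : ∀ {x}, x ∈ C → x ∉ D := fun hx hxD => ha ((h.saturation_iff (hCa hx)).2 hxD)
  have hDD : ∀ {x y}, eqv I x y → (x ∈ D ↔ y ∈ D) := fun hxy => h.saturation_iff hxy
  have hgD : ∀ x : C, g x ∉ D := by
    intro x hx
    refine hb ((hDD ?_).2 hx)
    have := (eqv_map g ⟨a 0, haC 0⟩ x).2 ((eqv_map C.subtype ⟨a 0, haC 0⟩ x).1 (hCa x.2))
    rwa [hg 0] at this
  have hcross : ∀ {x y : M}, (x ∈ D ∧ y ∉ D ∨ x ∉ D ∧ y ∈ D) → ¬ eqv I x y := by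
    intro x y hxy he
    have := hDD he
    tauto
  -- Glue the identity on `D` with `g` on `C`. Across components `wit` is the first projection and
  -- all binary relations fail, so `D ∪ C` is a substructure and the glued map `φ` is an embedding.
  let S : (lang I).Substructure M := mkSub (D ∪ C) (by
    rintro x (hx | hx) y (hy | hy)
    · exact Or.inl ((hDD (h.wit_eqv x y)).1 hx)
    · exact Or.inl ((hDD (h.wit_eqv x y)).1 hx)
    · rw [h.wit_eq x y (hcross (Or.inr ⟨hCD hx, hy⟩))]
      exact Or.inr hx
    · exact Or.inr (wit_mem C hx hy))
  have hSC : ∀ x : S, x.1 ∉ D → x.1 ∈ C := fun x hx => x.2.resolve_left hx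
  let φ : S → M := fun x => if hx : x.1 ∈ D then x.1 else g ⟨x.1, hSC x hx⟩
  have hφD : ∀ x : S, x.1 ∈ D → φ x = x.1 := fun x hx => dif_pos hx
  have hφC : ∀ (x : S) (hx : x.1 ∉ D), φ x = g ⟨x.1, hSC x hx⟩ := fun x hx => dif_neg hx
  have hφ : ∀ x : S, φ x ∈ D ↔ x.1 ∈ D := by
    intro x
    by_cases hx : x.1 ∈ D
    · rw [hφD x hx]
    · rw [hφC x hx]
      exact iff_of_false (hgD _) hx
  have hrel : ∀ (r : ∀ {X : Type u} [(lang I).Structure X], X → X → Prop),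
      (∀ {X Y : Type u} [(lang I).Structure X] [(lang I).Structure Y] (f : X ↪[lang I] Y)
        (x y : X), r (f x) (f y) ↔ r x y) → (∀ x y : M, r x y → eqv I x y) →
      ∀ x y : S, r (φ x) (φ y) ↔ r x y := by
    intro r hr hre x y
    rw [← hr S.subtype]
    change _ ↔ r x.1 y.1
    by_cases hx : x.1 ∈ D <;> by_cases hy : y.1 ∈ D
    · rw [hφD x hx, hφD y hy]
    · exact iff_of_false
        (fun hxy => hcross (Or.inl ⟨(hφ x).2 hx, mt (hφ y).1 hy⟩) (hre _ _ hxy))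
        (fun hxy => hcross (Or.inl ⟨hx, hy⟩) (hre _ _ hxy))
    · exact iff_of_false
        (fun hxy => hcross (Or.inr ⟨mt (hφ x).1 hx, (hφ y).2 hy⟩) (hre _ _ hxy))
        (fun hxy => hcross (Or.inr ⟨hx, hy⟩) (hre _ _ hxy))
    · rw [hφC x hx, hφC y hy, hr g]
      exact (hr C.subtype _ _).symm
  have hwS : ∀ x y : S, (wit I x y).1 = wit I x.1 y.1 := fun x y => (wit_map S.subtype x y).symm
  let f : S ↪[lang I] M := mkEmb φ
    (by
      intro x y hxy
      refine Subtype.ext ?_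
      by_cases hx : x.1 ∈ D
      · have hy : y.1 ∈ D := (hφ y).1 (hxy ▸ (hφ x).2 hx)
        rwa [hφD x hx, hφD y hy] at hxy
      · have hy : y.1 ∉ D := mt (hφ y).2 (hxy ▸ mt (hφ x).1 hx)
        rw [hφC x hx, hφC y hy] at hxy
        exact congrArg (fun z : C => z.1) (g.injective hxy))
    (by
      intro x y
      by_cases hx : x.1 ∈ D
      · have hxy : (wit I x y).1 ∈ D := by
          rw [hwS]
          exact (hDD (h.wit_eqv _ _)).1 hx
        rw [hφD _ hxy, hφD x hx, hwS]
        by_cases hy : y.1 ∈ D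
        · rw [hφD y hy]
        · rw [h.wit_eq _ _ (hcross (Or.inl ⟨hx, hy⟩)),
            h.wit_eq _ _ (hcross (Or.inl ⟨hx, mt (hφ y).1 hy⟩))]
      · by_cases hy : y.1 ∈ D
        · rw [h.wit_eq _ _ (hcross (Or.inr ⟨mt (hφ x).1 hx, (hφ y).2 hy⟩))]
          congr 1
          refine Subtype.ext ?_
          rw [hwS, h.wit_eq _ _ (hcross (Or.inr ⟨hx, hy⟩))]
        · have hxy : (wit I x y).1 ∉ D := by
            rw [hwS]
            exact mt (hDD (h.wit_eqv _ _)).2 hx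
          rw [hφC _ hxy, hφC x hx, hφC y hy, wit_map g]
          congr 1
          refine Subtype.ext ?_
          refine (hwS x y).trans ?_
          exact wit_map C.subtype ⟨x.1, hSC x hx⟩ ⟨y.1, hSC y hy⟩)
    (by
      intro i x
      rw [← lev_map S.subtype]
      change _ ↔ lev i x.1
      by_cases hx : x.1 ∈ D
      · rw [hφD x hx]
      · rw [hφC x hx, lev_map g]
        exact (lev_map C.subtype _ _).symm)
    (hrel (eqv I) eqv_map fun _ _ h => h) (hrel (mem I) mem_map h.mem_eqv)
    (hrel (ord I) ord_map h.ord_eqv)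
  have hAD : ∀ x : A, x.1 ∈ D := fun x => mem_saturation.2 ⟨x.1, x.2, h.refl _⟩
  refine cls_isHereditary.quot_mk_eq _ _ S ⟨⟨a 0, Or.inr (haC 0)⟩⟩ (fun x => Or.inl (hAD x))
    (fun i => Or.inr (haC i)) f (fun x => hφD ⟨x.1, _⟩ (hAD x)) fun i => ?_
  exact (hφC ⟨a i, _⟩ (hCD (haC i))).trans (hg i)

theorem cls_stable : (cls c β).Stable := by
  let T := Set ((lang I).Term (ULift.{u} (Fin 1)) × (lang I).Term (ULift.{u} (Fin 1))) ×
    Set (Σ n, (lang I).Relations n × (Fin n → (lang I).Term (ULift.{u} (Fin 1))))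
  -- `|V_β|` bounds each component meeting `A`, and `#T` bounds the atomic types of single elements,
  -- which control the types realized elsewhere.
  let μ := max (max (cls c β).LS ℵ₀) (max (ZFSet.vonNeumann β).card #T)
  have hμ : ℵ₀ ≤ μ := (le_max_right _ _).trans (le_max_left _ _)
  refine ⟨μ, (le_max_left _ _).trans (le_max_left _ _), ?_⟩
  intro M _ hM A hA
  let G : (Fin 1 → M) → Σ n : ℕ, (cls c β).GaloisType (Fin n) A := fun a => ⟨1, AEC.gtp hM A a⟩
  let tp : (Fin 1 → M) → T := fun a => (lang I).atomicType fun i : ULift.{u} (Fin 1) => a i.down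
  have hD : #(saturation I A) ≤ μ := by
    refine (Cardinal.mk_iUnion_le_sum_mk).trans ?_
    refine (Cardinal.sum_le_sum (fun a : A => #{y | eqv I a.1 y}) (fun _ => μ)
      fun a : A => (hM.2.mk_class_le a.1).trans ((le_max_left _ _).trans (le_max_right _ _))).trans ?_
    rw [Cardinal.sum_const']
    exact (mul_le_mul_left hA μ).trans (Cardinal.mul_eq_self hμ).le
  have hsub : AEC.typesLTTwo hM A ⊆ {⟨0, AEC.gtp hM A Fin.elim0⟩} ∪
      ((fun x => G fun _ => x) '' saturation I A ∪ G '' {a | a 0 ∉ saturation I A}) := by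
    rintro _ ⟨n, hn, a, rfl⟩
    interval_cases n
    · rw [Subsingleton.elim a Fin.elim0]
      exact Or.inl rfl
    · right
      by_cases ha : a 0 ∈ saturation I A
      · left
        refine ⟨a 0, ha, ?_⟩
        have : (fun _ => a 0) = a := funext fun i => by rw [Subsingleton.elim i 0]
        simp only [G, this]
      · exact Or.inr ⟨a, ha, rfl⟩
  have hlift : ℵ₀ ≤ Cardinal.lift.{u + 1} μ := Cardinal.aleph0_le_lift.2 hμ
  refine (Cardinal.mk_le_mk_of_subset hsub).trans ((Cardinal.mk_union_le _ _).trans ?_)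
  refine Cardinal.add_le_of_le hlift ?_ ((Cardinal.mk_union_le _ _).trans
    (Cardinal.add_le_of_le hlift ?_ ?_))
  · rw [Cardinal.mk_singleton]
    exact Cardinal.one_le_aleph0.trans hlift
  · have := Cardinal.mk_image_le_lift (f := fun x => G fun _ => x) (s := saturation I A)
    rw [Cardinal.lift_id'.{u, u + 1}] at this
    exact this.trans (Cardinal.lift_le.2 hD)
  · choose r hr hrG using fun p : G '' {a | a 0 ∉ saturation I A} => p.2
    have hinj : Function.Injective fun p => tp (r p) := by
      intro p q hpq
      refine Subtype.ext ?_
      rw [← hrG p, ← hrG q]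
      exact congrArg (Sigma.mk 1) (gtp_eq_of_notMem_saturation hM (hr p) (hr q) hpq)
    have := Cardinal.mk_le_of_injective
      (f := fun p => ULift.up.{u + 1} (tp (r p))) (ULift.up_injective.comp hinj)
    rw [Cardinal.mk_uLift] at this
    exact this.trans (Cardinal.lift_le.2 ((le_max_right _ _).trans (le_max_right _ _)))

end Stability

variable {I : Type u} {c : Ordinal.{u} → Set I} {β : Ordinal.{u}}

/-! ### The order property, from `V_β` with an arbitrary relation. -/

section OrderProperty

/-- The element of `V_ β` with a given name. -/
noncomputable def toZFSet (x : Shrink (ZFSet.vonNeumann β)) : ZFSet.{u} :=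
  ((equivShrink _).symm x).1

theorem toZFSet_injective : Function.Injective (toZFSet (β := β)) :=
  Subtype.val_injective.comp (equivShrink _).symm.injective

theorem toZFSet_mem (x : Shrink (ZFSet.vonNeumann β)) : toZFSet x ∈ ZFSet.vonNeumann β :=
  ((equivShrink _).symm x).2

theorem exists_toZFSet_eq {z : ZFSet.{u}} (hz : z ∈ ZFSet.vonNeumann β) :
    ∃ x : Shrink (ZFSet.vonNeumann β), toZFSet x = z :=
  ⟨equivShrink _ ⟨z, hz⟩, by simp [toZFSet]⟩

/-- As `V_β` is transitive, a set separating two of its elements lies in it. -/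
theorem exists_mem_not_iff {x y : Shrink (ZFSet.vonNeumann β)} (hxy : x ≠ y) :
    ∃ z : Shrink (ZFSet.vonNeumann β), ¬ (toZFSet z ∈ toZFSet x ↔ toZFSet z ∈ toZFSet y) := by
  by_contra! h
  refine hxy (toZFSet_injective (ZFSet.ext fun z => ⟨fun hz => ?_, fun hz => ?_⟩))
  · obtain ⟨w, rfl⟩ :=
      exists_toZFSet_eq ((ZFSet.isTransitive_vonNeumann β).mem_trans hz (toZFSet_mem x))
    exact (h w).1 hz
  · obtain ⟨w, rfl⟩ :=
      exists_toZFSet_eq ((ZFSet.isTransitive_vonNeumann β).mem_trans hz (toZFSet_mem y))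
    exact (h w).2 hz

open Classical in
/-- The structure on `V_ β` with a prescribed binary relation. -/
@[reducible] noncomputable def vonNeumannStr (c : Ordinal.{u} → Set I)
    (R : Shrink (ZFSet.vonNeumann β) → Shrink (ZFSet.vonNeumann β) → Prop) :
    (lang I).Structure (Shrink (ZFSet.vonNeumann β)) :=
  mkStr I (fun i x => i ∈ c (toZFSet x).rank) (fun _ _ => True)
    (fun x y => toZFSet x ∈ toZFSet y) R
    fun x y => if h : x ≠ y then (exists_mem_not_iff h).choose else x

/-- Injectivity of the coding makes the true rank the only level of an element, so membership lowers
levels. -/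
theorem vonNeumannStr_good (hc : Set.InjOn c (Set.Iio β))
    (R : Shrink (ZFSet.vonNeumann β) → Shrink (ZFSet.vonNeumann β) → Prop) :
    letI := vonNeumannStr c R
    Good (Shrink (ZFSet.vonNeumann β)) c β := by
  let := vonNeumannStr c R
  have hlev : ∀ x : Shrink (ZFSet.vonNeumann β), HasLevel c β x (toZFSet x).rank :=
    fun x => ⟨ZFSet.mem_vonNeumann.1 (toZFSet_mem x), fun i => Iff.rfl⟩
  have huniq : ∀ (x : Shrink (ZFSet.vonNeumann β)) (o), HasLevel c β x o →
      o = (toZFSet x).rank := fun x o ho => hc ho.1 (hlev x).1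
    (Set.ext fun i => (ho.2 i).symm.trans ((hlev x).2 i))
  exact
    { refl := fun _ => trivial
      symm := fun _ _ _ => trivial
      trans := fun _ _ _ _ _ => trivial
      lev := fun x => ⟨_, hlev x⟩
      mem_eqv := fun _ _ _ => trivial
      ord_eqv := fun _ _ _ => trivial
      mem_lt := fun x y hxy v w hv hw => by
        rw [huniq x v hv, huniq y w hw]
        exact ZFSet.rank_lt_of_mem hxy
      wit_eqv := fun _ _ => trivial
      wit_eq := fun _ _ h => absurd trivial h
      ext := fun x y _ hxy => by
        have : wit I x y = (exists_mem_not_iff hxy).choose := dif_pos hxy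
        rw [this]
        exact (exists_mem_not_iff hxy).choose_spec }

/-- Whether the first element of a pair is related to the second one depends only on the
Galois type of the pair. -/
theorem ord_iff_of_gtp_eq {M : Type u} [(lang I).Structure M] (hM : (cls c β).Mem M)
    {a b : Fin (1 + 1) → M} (h : (cls c β).gtp hM ∅ a = (cls c β).gtp hM ∅ b) :
    ord I (a 0) (a 1) ↔ ord I (b 0) (b 1) := by
  refine iff_of_eq (congrArg (Quot.lift
    (fun r : (cls c β).PreType (Fin (1 + 1)) (∅ : Set M) => ord I (r.tuple 0) (r.tuple 1)) ?_) h)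
  rintro p q ⟨P, _, f, g, -, -, -, hfg⟩
  exact propext (by rw [← ord_map f, ← ord_map g, hfg, hfg])

/-- The only demand on `ord` is to stay within components, and `V_β` is a single one. So `ord` may
be a well-order of type `μ` carried over by an injection, and it is visible in types of pairs; arity
one suffices. -/
theorem cls_hasOrderProperty (hc : Set.InjOn c (Set.Iio β)) (hβ : 0 < β) {μ : Cardinal.{u}}
    (hμ : μ ≤ (ZFSet.vonNeumann β).card) : (cls c β).HasOrderProperty μ := by
  have : #μ.ord.ToType ≤ #(Shrink (ZFSet.vonNeumann β)) := by
    rwa [Cardinal.mk_ord_toType]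
  obtain ⟨e⟩ := this
  let R : Shrink (ZFSet.vonNeumann β) → Shrink (ZFSet.vonNeumann β) → Prop :=
    fun x y => ∃ i j, i < j ∧ e i = x ∧ e j = y
  have hR : ∀ i j, R (e i) (e j) ↔ i < j := by
    intro i j
    constructor
    · rintro ⟨i', j', h, hi, hj⟩
      rwa [e.injective hi, e.injective hj] at h
    · exact fun h => ⟨i, j, h, rfl, rfl⟩
  let := vonNeumannStr c R
  have hne : Nonempty (Shrink (ZFSet.vonNeumann β)) := by
    obtain ⟨x, -⟩ := exists_toZFSet_eq (β := β) (z := ∅)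
      (ZFSet.mem_vonNeumann.2 (by rwa [ZFSet.rank_empty]))
    exact ⟨x⟩
  have hM : (cls c β).Mem (Shrink (ZFSet.vonNeumann β)) := ⟨hne, vonNeumannStr_good hc R⟩
  refine ⟨1, le_rfl, _, _, hM, fun i _ => e i, fun i₀ i₁ j₀ j₁ hi hj h => ?_⟩
  have := (ord_iff_of_gtp_eq hM h).1 ((hR i₀ i₁).2 hi)
  exact lt_asymm hj ((hR j₁ j₀).1 this)

end OrderProperty

/-! ### Failure of amalgamation. -/

section Amalgamation

/-- A point. -/
structure Point (c : Ordinal.{u} → Set I) : Type u where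

/-- The point has rank one. -/
instance (c : Ordinal.{u} → Set I) : (lang I).Structure (Point c) :=
  mkStr I (fun i _ => i ∈ c 1) (fun _ _ => True) (fun _ _ => False) (fun _ _ => False)
    fun x _ => x

/-- The two elements `⟨false⟩` and `⟨true⟩`. -/
structure Pair (c : Ordinal.{u} → Set I) (R : Prop) : Type u where
  /-- the truth value -/
  val : Bool

/-- The element `⟨false⟩` has rank zero and is a member of `⟨true⟩`, which has rank one; the two are
related when `R` holds. -/
instance (c : Ordinal.{u} → Set I) (R : Prop) : (lang I).Structure (Pair c R) :=
  mkStr I (fun i x => i ∈ c (if x.val then 1 else 0)) (fun _ _ => True)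
    (fun x y => x.val = false ∧ y.val = true)
    -- The conjunction gives the witness `⟨false⟩` for distinct elements, while `⟨true⟩` alone
    -- remains closed under `wit`, as its use as a substructure requires.
    (fun x y => R ∧ x.val = false ∧ y.val = true) fun x y => ⟨x.val && y.val⟩

theorem Pair.hasLevel (hβ : 1 < β) {R : Prop} (x : Pair c R) :
    HasLevel c β x (if x.val then 1 else 0) := by
  refine ⟨?_, fun i => Iff.rfl⟩
  split_ifs
  exacts [hβ, zero_lt_one.trans hβ]

theorem Pair.good (hc : Set.InjOn c (Set.Iio β)) (hβ : 1 < β) (R : Prop) :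
    Good (Pair c R) c β := by
  have hlev := Pair.hasLevel (c := c) hβ (R := R)
  have huniq : ∀ (x : Pair c R) (o), HasLevel c β x o → o = if x.val then 1 else 0 :=
    fun x o ho => hc ho.1 (hlev x).1 (Set.ext fun i => (ho.2 i).symm.trans ((hlev x).2 i))
  exact
    { refl := fun _ => trivial
      symm := fun _ _ _ => trivial
      trans := fun _ _ _ _ _ => trivial
      lev := fun x => ⟨_, hlev x⟩
      mem_eqv := fun _ _ _ => trivial
      ord_eqv := fun _ _ _ => trivial
      mem_lt := fun x y hxy v w hv hw => by
        obtain ⟨hx, hy⟩ : x.val = false ∧ y.val = true := hxy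
        rw [huniq x v hv, huniq y w hw, hx, hy]
        simp
      wit_eqv := fun _ _ => trivial
      wit_eq := fun _ _ h => absurd trivial h
      ext := by
        rintro ⟨x⟩ ⟨y⟩ - hxy
        change ¬ ((x && y) = false ∧ x = true ↔ (x && y) = false ∧ y = true)
        cases x <;> cases y <;> simp_all }

/-- The embedding of a point of rank one. -/
def pointEmb (c : Ordinal.{u} → Set I) (R : Prop) : Point c ↪[lang I] Pair c R :=
  mkEmb (fun _ => ⟨true⟩) (fun _ _ _ => rfl) (fun _ _ => rfl) (fun _ _ => Iff.rfl)
    (fun _ _ => Iff.rfl) (fun _ _ => iff_of_false (fun h => Bool.noConfusion h.1) fun h => h)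
    fun _ _ => iff_of_false (fun h => Bool.noConfusion h.2.1) fun h => h

/-- An element of level zero has no members, so extensionality leaves at most one in each component.
-/
theorem Good.eq_of_level_zero {M : Type u} [(lang I).Structure M] (h : Good M c β) {x y : M}
    (hxy : eqv I x y) (hx : HasLevel c β x 0) (hy : HasLevel c β y 0) : x = y := by
  have hmem : ∀ {w z : M}, HasLevel c β w 0 → ¬ mem I z w := fun {w z} hw hz => by
    obtain ⟨v, hv⟩ := h.lev z
    exact not_lt_bot (h.mem_lt z w hz v 0 hv hw)
  by_contra hne
  exact h.ext x y hxy hne (iff_of_false (hmem hx) (hmem hy))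

/-- Extend a point of rank one by a rank-zero member, related to it by `ord` in one extension and
not in the other. An amalgam would have to identify the two new members. -/
theorem cls_not_ap (hc : Set.InjOn c (Set.Iio β)) (hβ : 1 < β) : ¬ (cls c β).AP := by
  intro hAP
  have hf : ∀ R : Prop, (cls c β).IsStrong (pointEmb c R) := fun R =>
    cls_isHereditary _ ⟨⟨⟩⟩ ⟨⟨⟨true⟩⟩, Pair.good hc hβ R⟩
  obtain ⟨N, _, g₁, g₂, hg₁, -, hg⟩ := hAP _ _ (hf True) (hf False)
  have hN : Good N c β := ((cls c β).mem_of_isStrong _ hg₁).2.2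
  have htop : g₁ ⟨true⟩ = g₂ ⟨true⟩ := hg ⟨⟩
  have he₁ : eqv I (g₁ ⟨false⟩) (g₁ ⟨true⟩) := (eqv_map g₁ _ _).2 trivial
  have he₂ : eqv I (g₂ ⟨true⟩) (g₂ ⟨false⟩) := (eqv_map g₂ _ _).2 trivial
  have hbot : g₁ ⟨false⟩ = g₂ ⟨false⟩ :=
    hN.eq_of_level_zero (hN.trans _ _ _ he₁ (htop ▸ he₂))
      ((hasLevel_map c β g₁ _ _).2 (Pair.hasLevel hβ _))
      ((hasLevel_map c β g₂ _ _).2 (Pair.hasLevel hβ _))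
  have h₁ : ord I (g₁ ⟨false⟩) (g₁ ⟨true⟩) := (ord_map g₁ _ _).2 ⟨trivial, rfl, rfl⟩
  rw [htop, hbot] at h₁
  exact ((ord_map g₂ _ _).1 h₁).1

end Amalgamation

/-! ### Cardinal arithmetic and the main theorem. -/

/-- The hierarchy `preBeth` starts from zero and reaches at least `κ` after `κ.ord` steps; from
there both sides grow by the same recursion. -/
theorem bethOver_le_preBeth (κ : Cardinal.{u}) (o : Ordinal.{u}) :
    bethOver κ o ≤ Cardinal.preBeth (κ.ord + o) := by
  induction o using Ordinal.limitRecOn with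
  | zero =>
    rw [bethOver_zero, add_zero]
    exact Cardinal.le_preBeth_ord κ
  | add_one o ih =>
    rw [← Order.succ_eq_add_one, bethOver_succ, Order.succ_eq_add_one, ← add_assoc,
      Cardinal.preBeth_add_one]
    exact Cardinal.power_le_power_left two_ne_zero ih
  | limit o ho ih =>
    rw [bethOver_limit κ o ho]
    exact ciSup_le' fun a => (ih a.1 a.2).trans
      (Cardinal.preBeth_mono (add_le_add le_rfl (le_of_lt a.2)))

theorem exists_injOn_Iio (I : Type u) {β : Ordinal.{u}} (hβ : β.card ≤ 2 ^ #I) :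
    ∃ c : Ordinal.{u} → Set I, Set.InjOn c (Set.Iio β) := by
  have : Cardinal.lift.{u} #(Set.Iio β) ≤ Cardinal.lift.{u + 1} #(Set I) := by
    rw [Cardinal.lift_id'.{u, u + 1}, Cardinal.mk_Iio_ordinal, Cardinal.mk_set]
    exact Cardinal.lift_le.2 hβ
  obtain ⟨e⟩ := Cardinal.lift_mk_le'.1 this
  classical
  refine ⟨fun o => if h : o ∈ Set.Iio β then e ⟨o, h⟩ else ∅, fun x hx y hy hxy => ?_⟩
  simp only [dif_pos hx, dif_pos hy] at hxy
  exact congrArg Subtype.val (e.injective hxy)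

end RankedSets

theorem mainTheorem2 (lam : Cardinal.{u}) (hlam : ℵ₀ ≤ lam) (γ : Ordinal.{u})
    (hγ : lam.ord ≤ γ) (hγ' : γ < (Order.succ ((2 : Cardinal.{u}) ^ lam)).ord) :
    ∃ (L : FirstOrder.Language.{u, u}) (K : AEC L),
      K.Stable ∧ K.LS = lam ∧
      (∀ μ : Cardinal.{u}, ℵ₀ ≤ μ → μ ≤ bethOver lam γ → K.HasOrderProperty μ) ∧
      K.JEP ∧ K.NMM ∧ K.Tame ℵ₀ ∧ ¬ K.AP := by
  have hI : #lam.out = lam := Cardinal.mk_out lam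
  have hω : Ordinal.omega0 ≤ lam.ord + γ :=
    (Cardinal.ord_aleph0 ▸ Cardinal.ord_le_ord.2 hlam).trans le_self_add
  have h2 : ℵ₀ ≤ (2 : Cardinal.{u}) ^ lam := hlam.trans (Cardinal.cantor lam).le
  -- The height is `lam.ord + γ` so that `|V_β|` reaches `ℶ_γ(λ)`. The extra summand costs nothing,
  -- since both parts have at most `2 ^ λ` elements.
  have hcard : (lam.ord + γ).card ≤ 2 ^ #lam.out := by
    rw [hI, Ordinal.card_add, Cardinal.card_ord]
    exact Cardinal.add_le_of_le h2 (Cardinal.cantor lam).le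
      (Order.lt_succ_iff.1 (Cardinal.lt_ord.1 hγ'))
  obtain ⟨c, hc⟩ := RankedSets.exists_injOn_Iio lam.out hcard
  have h1 : 1 < lam.ord + γ := Ordinal.one_lt_omega0.trans_le hω
  refine ⟨RankedSets.lang lam.out, RankedSets.cls c (lam.ord + γ), RankedSets.cls_stable,
    ?_, fun μ _ hμ => ?_, RankedSets.cls_jep, RankedSets.cls_nmm,
    RankedSets.cls_isHereditary.tame RankedSets.cls_jep, RankedSets.cls_not_ap hc h1⟩
  · rw [RankedSets.cls_isHereditary.LS_eq, RankedSets.max_aleph0_card_lang (hlam.trans_eq hI.symm),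
      hI]
  · refine RankedSets.cls_hasOrderProperty hc (zero_lt_one.trans h1) (hμ.trans ?_)
    rw [ZFSet.card_vonNeumann]
    exact RankedSets.bethOver_le_preBeth lam γ
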